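/- A \emph{concrete domain} is a relational structure $\mathfrak{D}=(D,P_1^D,P_2^D,\dots)$ over a countable relational signature, where each predicate $P_i$ has an arity $k_i\in\mathbb{N}$ and $P_i^D\subseteq D^{k_i}$. It is \emph{jointly diagonal} (JD) if there is a quantifier-free, equality-free first-order formula $\phi_{=}(x,y)$ over its signature that defines equality between two elements of $D$. Fix countably infinite, pairwise disjoint sets of concept, role, individual and feature names. An \emph{interpretation} $\mathcal{I}$ consists of a non-empty domain $\Delta$, sets $A^{\mathcal I}\subseteq\Delta$, relations $r^{\mathcal I}\subseteq\Delta\times\Delta$, elements $a^{\mathcal I}\in\Delta$ and partial functions $f^{\mathcal I}\colon\Delta\rightharpoonup D$ for concept names $A$, role names $r$, individual names $a$ and feature names $f$. Let $r^{\mathcal I}(d)=\{e\mid(d,e)\in r^{\mathcal I}\}$ and $\mathrm{ars}^{\mathcal I}(d)=\bigcup_r r^{\mathcal I}(d)$; $\mathcal I$ is \emph{finitely branching} if every $\mathrm{ars}^{\mathcal I}(d)$ is finite. \emph{Concepts} of $\mathcal{ALCOSCC}(\mathfrak D)$ \emph{with mixed numerical constraints} are built from concept names $A$, nominals $\{a\}$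 (interpreted as $\{a^{\mathcal I}\}$), negation, conjunction, existential restrictions $\exists r.C$, and the following. \begin{itemize} \item CD-restrictions $\exists p_1,\dots,p_k.P$, where $P$ is a $k$-ary predicate and each $p_i$ is a feature path $f$ or $rf$: $d$ belongs to it iff some tuple in $p_1^{\mathcal I}(d)\times\dots\times p_k^{\mathcal I}(d)$ is in $P^D$, where $f^{\mathcal I}(d)$ is viewed as a set with at most one element and $(rf)^{\mathcal I}(d)$ is the set of all defined values $f^{\mathcal I}(e)$ with $e\in r^{\mathcal I}(d)$. \item Successor restrictions $\mathrm{succ}(\mathfrak{con})$, where $\mathfrak{con}$ is a constraint $s\subseteq t$, $s=t$, $\ell=\ell'$, $\ell<\ell'$, $n\mathrel{\mathrm{div}}\ell$ ($n\in\mathbb N$), or a mixed numerical constraint $f=\ell$ with $f$ a feature name. Here set terms $s,t$ are built by intersection, union and complement from $\emptyset$, $\mathcal U$, role names, concepts, and feature roles $P(\alpha_1,\dots,\alpha_k)$, where $P$ is a $k$-ary predicate and each $\alpha_i$ is $f$ or $\mathrm{next}\,f$ for a feature name $f$; and $\ell,\ell'$ are Presburger expressions $n_0+n_1|s_1|+\dots+n_m|s_m|$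 with $n_i\in\mathbb N$ and set terms $s_i$. At $d$, set terms and expressions are evaluated under the assignment $\sigma_d$ with $\sigma_d(\mathcal U)=\mathrm{ars}^{\mathcal I}(d)$, $\sigma_d(r)=r^{\mathcal I}(d)$, $\sigma_d(C)=C^{\mathcal I}\cap\mathrm{ars}^{\mathcal I}(d)$, and $\sigma_d(P(\alpha_1,\dots,\alpha_k))$ the set of $e\in\mathrm{ars}^{\mathcal I}(d)$ with $(c_1,\dots,c_k)\in P^D$, where $c_i=f^{\mathcal I}(d)$ if $\alpha_i=f$, $c_i=f^{\mathcal I}(e)$ if $\alpha_i=\mathrm{next}\,f$, and all $c_i$ must be defined; complements are taken relative to $\mathrm{ars}^{\mathcal I}(d)$. Then $d\in\mathrm{succ}(\mathfrak{con})^{\mathcal I}$ iff $\sigma_d$ satisfies $\mathfrak{con}$; in particular $d\in\mathrm{succ}(f=\ell)^{\mathcal I}$ iff $f^{\mathcal I}(d)$ is defined and equals $\sigma_d(\ell)$. \end{itemize} A \emph{TBox} is a finite set of concept inclusions $C\sqsubseteq C'$ between such concepts; it is \emph{consistent} if there is a finitely branching interpretation $\mathcal I$ with $C^{\mathcal I}\subseteq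 C'^{\mathcal I}$ for all its inclusions. \textbf{Theorem.} Let $\mathfrak D$ be a concrete domain whose domain set $D$ is $\mathbb N$, $\mathbb Z$ or $\mathbb Q$. If $\mathfrak D$ is jointly diagonal, then consistency of $\mathcal{ALCOSCC}(\mathfrak D)$ TBoxes with mixed numerical constraints is undecidable: whatever injective numbering of the predicates is used to encode TBoxes by natural numbers via a fixed standard coding of syntax trees, no algorithm decides, given the code of a TBox, whether the TBox is consistent. -/

import Mathlib

/-! ### Concrete domains

A concrete domain is a first-order structure (`FirstOrder.Language.Structure`) with carrier `D` over
a relational language `L`, whose relation symbols are the predicates. -/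

/-- The formula contains no equality atom. -/
def EqualityFree {L : FirstOrder.Language.{0, 0}} {α : Type} :
    {n : ℕ} → L.BoundedFormula α n → Prop
  | _, .falsum => True
  | _, .equal _ _ => False
  | _, .rel _ _ => True
  | _, .imp φ ψ => EqualityFree φ ∧ EqualityFree ψ
  | _, .all φ => EqualityFree φ

/-- Condition JD (jointly diagonal): a quantifier-free, equality-free first-order formula
`φ(x, y)` over the signature defines equality between two elements of `D`. -/
def JointlyDiagonal (L : FirstOrder.Language.{0, 0}) (D : Type) [L.Structure D] : Prop :=
  ∃ φ : L.Formula (Fin 2), φ.IsQF ∧ EqualityFree φ ∧ ∀ a b : D, φ.Realize ![a, b] ↔ a = b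

/-! ### Syntax

There are countably infinitely many names of each of the four kinds. -/

abbrev ConceptName := ℕ
abbrev RoleName := ℕ
abbrev IndividualName := ℕ
abbrev FeatureName := ℕ

/-- Feature paths `f` and `r f`. -/
inductive FeaturePath : Type where
  | feature (f : FeatureName)
  | roleFeature (r : RoleName) (f : FeatureName)

/-- Feature pointers `f` and `next f`. -/
inductive FeaturePointer : Type where
  | here (f : FeatureName)
  | next (f : FeatureName)

mutual

/-- Concepts of ALCOSCC(𝔇) with mixed numerical constraints. -/
inductive DLConcept (L : FirstOrder.Language.{0, 0}) : Type where
  | atom (A : ConceptName)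
  | nominal (a : IndividualName)
  | neg (C : DLConcept L)
  | and (C C' : DLConcept L)
  /-- existential restriction `∃ r. C` -/
  | ex (r : RoleName) (C : DLConcept L)
  /-- CD-restriction `∃ p₁, …, p_k. P` -/
  | cd {k : ℕ} (P : L.Relations k) (p : Fin k → FeaturePath)
  /-- role successor restriction `succ(con)` -/
  | suc (con : SuccConstraint L)

/-- Set terms whose set variables are role names, concepts and feature roles
`P(α₁, …, α_k)`. -/
inductive SetTerm (L : FirstOrder.Language.{0, 0}) : Type where
  | empty
  | univ
  | role (r : RoleName)
  | concept (C : DLConcept L)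
  | featureRole {k : ℕ} (P : L.Relations k) (α : Fin k → FeaturePointer)
  | inter (s t : SetTerm L)
  | union (s t : SetTerm L)
  | compl (s : SetTerm L)

/-- Presburger arithmetic expressions `n₀ + n₁ |s₁| + ⋯ + n_k |s_k|`. -/
inductive PAExpr (L : FirstOrder.Language.{0, 0}) : Type where
  /-- `n₀` -/
  | const (n : ℕ)
  /-- `ℓ + n |s|` -/
  | addCard (l : PAExpr L) (n : ℕ) (s : SetTerm L)

/-- Set constraints, numerical constraints, and mixed numerical constraints `f = ℓ`. -/
inductive SuccConstraint (L : FirstOrder.Language.{0, 0}) : Type where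
  | setSubset (s t : SetTerm L)
  | setEq (s t : SetTerm L)
  | numEq (l l' : PAExpr L)
  | numLt (l l' : PAExpr L)
  | divides (n : ℕ) (l : PAExpr L)
  | mixed (f : FeatureName) (l : PAExpr L)

end

/-- A TBox: a finite collection of concept inclusions `C ⊑ C'`, given as a list of the pairs
`(C, C')`. -/
abbrev TBox (L : FirstOrder.Language.{0, 0}) := List (DLConcept L × DLConcept L)

/-! ### Semantics -/

/-- An interpretation with domain `Δ`; features are interpreted as partial functions into `D`. -/
structure Interpretation (Δ D : Type) where
  concept : ConceptName → Set Δ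
  role : RoleName → Δ → Δ → Prop
  individual : IndividualName → Δ
  feature : FeatureName → Δ → Option D

/-- The set `ars(d)` of all role successors of `d`. -/
def Interpretation.ars {Δ D : Type} (I : Interpretation Δ D) (d : Δ) : Set Δ :=
  {e | ∃ r, I.role r d e}

def Interpretation.FinitelyBranching {Δ D : Type} (I : Interpretation Δ D) : Prop :=
  ∀ d, (I.ars d).Finite

/-- The set of values of a feature path at `d`. -/
def FeaturePath.values {Δ D : Type} (I : Interpretation Δ D) (d : Δ) : FeaturePath → Set D
  | .feature f => {c | I.feature f d = some c}
  | .roleFeature r f => {c | ∃ e, I.role r d e ∧ I.feature f e = some c}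

/-- The value, if defined, of a feature pointer at the pair `(d, e)`. -/
def FeaturePointer.value {Δ D : Type} (I : Interpretation Δ D) (d e : Δ) :
    FeaturePointer → Option D
  | .here f => I.feature f d
  | .next f => I.feature f e

mutual

/-- The interpretation `C^I` of a concept. -/
noncomputable def DLConcept.interp {L : FirstOrder.Language.{0, 0}} {Δ D : Type}
    [L.Structure D] [NatCast D] (I : Interpretation Δ D) : DLConcept L → Set Δ
  | .atom A => I.concept A
  | .nominal a => {I.individual a}
  | .neg C => (C.interp I)ᶜ
  | .and C C' => C.interp I ∩ C'.interp I
  | .ex r C => {d | ∃ e, I.role r d e ∧ e ∈ C.interp I}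
  | .cd P p => {d | ∃ c, (∀ i, c i ∈ (p i).values I d) ∧ FirstOrder.Language.Structure.RelMap P c}
  | .suc con => {d | con.Holds I d}

/-- The value `σ_d(s)` of a set term, a subset of `ars(d)`. -/
noncomputable def SetTerm.eval {L : FirstOrder.Language.{0, 0}} {Δ D : Type}
    [L.Structure D] [NatCast D] (I : Interpretation Δ D) : SetTerm L → Δ → Set Δ
  | .empty, _ => ∅
  | .univ, d => I.ars d
  | .role r, d => {e | I.role r d e}
  | .concept C, d => C.interp I ∩ I.ars d
  | .featureRole P α, d =>
      {e | ∃ c, (∀ i, (α i).value I d e = some (c i)) ∧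
        FirstOrder.Language.Structure.RelMap P c} ∩ I.ars d
  | .inter s t, d => s.eval I d ∩ t.eval I d
  | .union s t, d => s.eval I d ∪ t.eval I d
  | .compl s, d => I.ars d \ s.eval I d

/-- The value `σ_d(ℓ)` of a Presburger arithmetic expression. -/
noncomputable def PAExpr.eval {L : FirstOrder.Language.{0, 0}} {Δ D : Type}
    [L.Structure D] [NatCast D] (I : Interpretation Δ D) : PAExpr L → Δ → ℕ
  | .const n, _ => n
  | .addCard l n s, d => l.eval I d + n * (s.eval I d).ncard

/-- `σ_d` satisfies the constraint; `f = ℓ` requires `f` to be defined at `d`. -/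
noncomputable def SuccConstraint.Holds {L : FirstOrder.Language.{0, 0}} {Δ D : Type}
    [L.Structure D] [NatCast D] (I : Interpretation Δ D) : SuccConstraint L → Δ → Prop
  | .setSubset s t, d => s.eval I d ⊆ t.eval I d
  | .setEq s t, d => s.eval I d = t.eval I d
  | .numEq l l', d => l.eval I d = l'.eval I d
  | .numLt l l', d => l.eval I d < l'.eval I d
  | .divides n l, d => n ∣ l.eval I d
  | .mixed f l, d => I.feature f d = some ((l.eval I d : ℕ) : D)

end

/-- A TBox is consistent if it has a model: a finitely branching interpretation with nonempty
domain that satisfies all its concept inclusions. -/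
def TBox.Consistent {L : FirstOrder.Language.{0, 0}} (D : Type) [L.Structure D] [NatCast D]
    (T : TBox L) : Prop :=
  ∃ (Δ : Type) (_ : Nonempty Δ) (I : Interpretation Δ D),
    I.FinitelyBranching ∧ ∀ ci ∈ T, ci.1.interp I ⊆ ci.2.interp I

/-! ### Gödel numbering of TBoxes -/

def FeaturePath.code : FeaturePath → ℕ
  | .feature f => Nat.pair 0 f
  | .roleFeature r f => Nat.pair 1 (Nat.pair r f)

def FeaturePointer.code : FeaturePointer → ℕ
  | .here f => Nat.pair 0 f
  | .next f => Nat.pair 1 f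

/-- The code of a predicate together with the codes of its arguments. -/
def codePred {L : FirstOrder.Language.{0, 0}} [Encodable (Σ k, L.Relations k)] {k : ℕ}
    (P : L.Relations k) (args : Fin k → ℕ) : ℕ :=
  Nat.pair (Encodable.encode (⟨k, P⟩ : Σ k, L.Relations k)) (Encodable.encode (List.ofFn args))

mutual

def DLConcept.code {L : FirstOrder.Language.{0, 0}} [Encodable (Σ k, L.Relations k)] :
    DLConcept L → ℕ
  | .atom A => Nat.pair 0 A
  | .nominal a => Nat.pair 1 a
  | .neg C => Nat.pair 2 C.code
  | .and C C' => Nat.pair 3 (Nat.pair C.code C'.code)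
  | .ex r C => Nat.pair 4 (Nat.pair r C.code)
  | .cd P p => Nat.pair 5 (codePred P fun i => (p i).code)
  | .suc con => Nat.pair 6 con.code

def SetTerm.code {L : FirstOrder.Language.{0, 0}} [Encodable (Σ k, L.Relations k)] :
    SetTerm L → ℕ
  | .empty => Nat.pair 0 0
  | .univ => Nat.pair 1 0
  | .role r => Nat.pair 2 r
  | .concept C => Nat.pair 3 C.code
  | .featureRole P α => Nat.pair 4 (codePred P fun i => (α i).code)
  | .inter s t => Nat.pair 5 (Nat.pair s.code t.code)
  | .union s t => Nat.pair 6 (Nat.pair s.code t.code)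
  | .compl s => Nat.pair 7 s.code

def PAExpr.code {L : FirstOrder.Language.{0, 0}} [Encodable (Σ k, L.Relations k)] :
    PAExpr L → ℕ
  | .const n => Nat.pair 0 n
  | .addCard l n s => Nat.pair 1 (Nat.pair l.code (Nat.pair n s.code))

def SuccConstraint.code {L : FirstOrder.Language.{0, 0}} [Encodable (Σ k, L.Relations k)] :
    SuccConstraint L → ℕ
  | .setSubset s t => Nat.pair 0 (Nat.pair s.code t.code)
  | .setEq s t => Nat.pair 1 (Nat.pair s.code t.code)
  | .numEq l l' => Nat.pair 2 (Nat.pair l.code l'.code)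
  | .numLt l l' => Nat.pair 3 (Nat.pair l.code l'.code)
  | .divides n l => Nat.pair 4 (Nat.pair n l.code)
  | .mixed f l => Nat.pair 5 (Nat.pair f l.code)

end

def TBox.code {L : FirstOrder.Language.{0, 0}} [Encodable (Σ k, L.Relations k)]
    (T : TBox L) : ℕ :=
  Encodable.encode (T.map fun ci => Nat.pair ci.1.code ci.2.code)

/-! The coding is injective. -/

theorem FeaturePath.code_injective : Function.Injective FeaturePath.code := by
  intro p q h
  cases p <;> cases q <;> simp_all [FeaturePath.code, Nat.pair_eq_pair]

theorem FeaturePointer.code_injective : Function.Injective FeaturePointer.code := by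
  intro p q h
  cases p <;> cases q <;> simp_all [FeaturePointer.code, Nat.pair_eq_pair]

theorem codePred_eq {L : FirstOrder.Language.{0, 0}} [Encodable (Σ k, L.Relations k)] {k k' : ℕ}
    {P : L.Relations k} {P' : L.Relations k'} {a : Fin k → ℕ} {a' : Fin k' → ℕ}
    (h : codePred P a = codePred P' a') : k = k' ∧ HEq P P' ∧ HEq a a' := by
  simp only [codePred, Nat.pair_eq_pair, Encodable.encode_inj, Sigma.mk.injEq] at h
  obtain ⟨⟨rfl, hP⟩, h2⟩ := h
  exact ⟨rfl, hP, heq_of_eq (List.ofFn_injective h2)⟩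

mutual

theorem DLConcept.code_inj {L : FirstOrder.Language.{0, 0}} [Encodable (Σ k, L.Relations k)]
    (C C' : DLConcept L) (h : C.code = C'.code) : C = C' := by
  cases C <;> cases C' <;> simp only [DLConcept.code, Nat.pair_eq_pair] at h <;>
    first
    | (exfalso; omega)
    | skip
  · rw [h.2]
  · rw [h.2]
  · rw [DLConcept.code_inj _ _ h.2]
  · rw [DLConcept.code_inj _ _ h.2.1, DLConcept.code_inj _ _ h.2.2]
  · rw [h.2.1, DLConcept.code_inj _ _ h.2.2]
  · obtain ⟨rfl, hP, ha⟩ := codePred_eq h.2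
    rw [eq_of_heq hP]
    congr 1
    funext i
    exact FeaturePath.code_injective (congrFun (eq_of_heq ha) i)
  · rw [SuccConstraint.code_inj _ _ h.2]

theorem SetTerm.code_inj {L : FirstOrder.Language.{0, 0}} [Encodable (Σ k, L.Relations k)]
    (s s' : SetTerm L) (h : s.code = s'.code) : s = s' := by
  cases s <;> cases s' <;> simp only [SetTerm.code, Nat.pair_eq_pair] at h <;>
    first
    | (exfalso; omega)
    | skip
  · rfl
  · rfl
  · rw [h.2]
  · rw [DLConcept.code_inj _ _ h.2]
  · obtain ⟨rfl, hP, ha⟩ := codePred_eq h.2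
    rw [eq_of_heq hP]
    congr 1
    funext i
    exact FeaturePointer.code_injective (congrFun (eq_of_heq ha) i)
  · rw [SetTerm.code_inj _ _ h.2.1, SetTerm.code_inj _ _ h.2.2]
  · rw [SetTerm.code_inj _ _ h.2.1, SetTerm.code_inj _ _ h.2.2]
  · rw [SetTerm.code_inj _ _ h.2]

theorem PAExpr.code_inj {L : FirstOrder.Language.{0, 0}} [Encodable (Σ k, L.Relations k)]
    (l l' : PAExpr L) (h : l.code = l'.code) : l = l' := by
  cases l <;> cases l' <;> simp only [PAExpr.code, Nat.pair_eq_pair] at h <;>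
    first
    | (exfalso; omega)
    | skip
  · rw [h.2]
  · rw [PAExpr.code_inj _ _ h.2.1, h.2.2.1, SetTerm.code_inj _ _ h.2.2.2]

theorem SuccConstraint.code_inj {L : FirstOrder.Language.{0, 0}} [Encodable (Σ k, L.Relations k)]
    (c c' : SuccConstraint L) (h : c.code = c'.code) : c = c' := by
  cases c <;> cases c' <;> simp only [SuccConstraint.code, Nat.pair_eq_pair] at h <;>
    first
    | (exfalso; omega)
    | skip
  · rw [SetTerm.code_inj _ _ h.2.1, SetTerm.code_inj _ _ h.2.2]
  · rw [SetTerm.code_inj _ _ h.2.1, SetTerm.code_inj _ _ h.2.2]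
  · rw [PAExpr.code_inj _ _ h.2.1, PAExpr.code_inj _ _ h.2.2]
  · rw [PAExpr.code_inj _ _ h.2.1, PAExpr.code_inj _ _ h.2.2]
  · rw [h.2.1, PAExpr.code_inj _ _ h.2.2]
  · rw [h.2.1, PAExpr.code_inj _ _ h.2.2]

end

theorem TBox.code_injective {L : FirstOrder.Language.{0, 0}} [Encodable (Σ k, L.Relations k)] :
    Function.Injective (TBox.code (L := L)) := by
  intro T T' h
  refine List.map_injective_iff.2 ?_ (Encodable.encode_injective h)
  rintro ⟨C, E⟩ ⟨C', E'⟩ h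
  simp only [Nat.pair_eq_pair] at h
  rw [DLConcept.code_inj _ _ h.1, DLConcept.code_inj _ _ h.2]

/-- The consistency problem for ALCOSCC(𝔇) TBoxes with mixed numerical constraints is decidable:
some computable predicate on the natural numbers gives the right answer on the code of each TBox
(nothing is required of it on numbers that are not codes). -/
def ConsistencyDecidable (L : FirstOrder.Language.{0, 0}) [Encodable (Σ k, L.Relations k)]
    (D : Type) [L.Structure D] [NatCast D] : Prop :=
  ∃ p : ℕ → Prop, ComputablePred p ∧ ∀ T : TBox L, p T.code ↔ T.Consistent D

-- The halting problem is reduced to inconsistency through an intermediate model: rewriting systems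
-- on finitely many natural registers, whose rules replace each `c j + m j * t j` by `b j + a j * t
-- j` for some `t j`. Both sides are Presburger expressions in `t j`, so letting `t j` be the number
-- of successors for a role of its own turns them into two mixed constraints, one for the old and
-- one for the new value. Mixed constraints only reach features of the current element. Joint
-- diagonality supplies the missing link: the equality formula, read as a set term, forces every
-- successor along role `0` to start with the new value (`JointlyDiagonal.exists_setTerm`). A TBox
-- demanding such a successor and some rule everywhere, plus initial values at a nominal, is
-- consistent iff an infinite run exists (`rewritingTBox_consistent_iff`). Affine rules suffice for
-- stack machines. A stack is a number in base `|G| + 1` with nonzero digits, so that emptiness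
-- test, push, peek and pop are affine patterns, and one further register holds the control state
-- (`hasInfiniteRun_opRules_iff`). Applied to a machine for a universal partial recursive function,
-- this yields a fixed system and computable initial values for which divergence is undecidable
-- (`exists_not_computablePred_hasInfiniteRun`).

/-! ### Propositional combinations of concepts -/

namespace DLConcept

variable {L : FirstOrder.Language.{0, 0}} {Δ D : Type} [L.Structure D] [NatCast D]
  {I : Interpretation Δ D} {d : Δ}

/-- The concept `⊤`. -/
def top (L : FirstOrder.Language.{0, 0}) : DLConcept L :=
  .neg (.and (.atom 0) (.neg (.atom 0)))

/-- Finite conjunctions of concepts. -/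
def conj : List (DLConcept L) → DLConcept L
  | [] => top L
  | C :: l => .and C (conj l)

/-- Finite disjunctions of concepts. -/
def disj (l : List (DLConcept L)) : DLConcept L :=
  .neg (conj (l.map .neg))

theorem interp_top : (top L).interp I = Set.univ := by
  simp [top, interp]

theorem mem_interp_conj {l : List (DLConcept L)} :
    d ∈ (conj l).interp I ↔ ∀ C ∈ l, d ∈ C.interp I := by
  induction l with
  | nil => simp [conj, interp_top]
  | cons C l ih => simp [conj, interp, ih]

theorem mem_interp_disj {l : List (DLConcept L)} :
    d ∈ (disj l).interp I ↔ ∃ C ∈ l, d ∈ C.interp I := by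
  simp [disj, interp, mem_interp_conj]

end DLConcept

/-! ### Feature equality as a set term -/

/-- The pointer to the value of `g` at the current element for the variable `0`, and to the value
of `f` at its successor for the other variable. -/
def pointerOf (g f : FeatureName) (i : Fin 2) : FeaturePointer :=
  if i = 0 then .here g else .next f

/-- Connectives become set operations and atoms become feature roles. Both values must be defined:
an undefined argument makes every feature role false, and complements would then no longer mirror
negation. The equation `n = 0` is a separate hypothesis so that the induction has a variable index.
-/
theorem exists_setTerm_of_isQF {L : FirstOrder.Language.{0, 0}} [L.IsRelational]
    (D : Type) [L.Structure D] [NatCast D] (g f : FeatureName) {n : ℕ}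
    {φ : L.BoundedFormula (Fin 2) n} (hφ : φ.IsQF) (hn : n = 0) (he : EqualityFree φ) :
    ∃ s : SetTerm L, ∀ {Δ : Type} (I : Interpretation Δ D) (d e : Δ) (a b : D) (xs : Fin n → D),
      e ∈ I.ars d → I.feature g d = some a → I.feature f e = some b →
      (e ∈ s.eval I d ↔ φ.Realize ![a, b] xs) := by
  induction hφ with
  | falsum => exact ⟨.empty, fun I d e a b xs _ _ _ => by
    simp [SetTerm.eval, FirstOrder.Language.BoundedFormula.Realize]⟩
  | of_isAtomic h =>
    cases h with
    | equal => exact he.elim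
    | rel R ts =>
      subst hn
      -- A relational signature has no function terms, and `n = 0` leaves no bound variables.
      have hv : ∀ i, ∃ v : Fin 2, ts i = .var (.inl v) := by
        intro i
        rcases h : ts i with v | ⟨F, _⟩
        · rcases v with v | v
          · exact ⟨v, rfl⟩
          · exact v.elim0
        · exact isEmptyElim F
      choose v hv using hv
      refine ⟨.featureRole R fun i => pointerOf g f (v i), fun I d e a b xs hde ha hb => ?_⟩
      have key : ∀ i, (pointerOf g f (v i)).value I d e = some (![a, b] (v i)) := by
        intro i
        generalize v i = j
        fin_cases j <;> simp [pointerOf, FeaturePointer.value, ha, hb]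
      simp only [SetTerm.eval, key, Option.some.injEq, Set.mem_inter_iff, Set.mem_ofPred_eq, hde,
        and_true, FirstOrder.Language.BoundedFormula.realize_rel, hv,
        FirstOrder.Language.Term.realize_var, Sum.elim_inl]
      constructor
      · rintro ⟨c, hc, h⟩
        rwa [funext hc]
      · exact fun h => ⟨_, fun _ => rfl, h⟩
  | imp h₁ h₂ ih₁ ih₂ =>
    obtain ⟨s, hs⟩ := ih₁ he.1
    obtain ⟨t, ht⟩ := ih₂ he.2
    refine ⟨.union (.compl s) t, fun I d e a b xs hde ha hb => ?_⟩
    simp only [SetTerm.eval, Set.mem_union, Set.mem_sdiff, hde, true_and, hs I d e a b xs hde ha hb,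
      ht I d e a b xs hde ha hb, FirstOrder.Language.BoundedFormula.realize_imp]
    tauto

theorem JointlyDiagonal.exists_setTerm {L : FirstOrder.Language.{0, 0}} [L.IsRelational]
    {D : Type} [L.Structure D] [NatCast D] (h : JointlyDiagonal L D) (g f : FeatureName) :
    ∃ s : SetTerm L, ∀ {Δ : Type} (I : Interpretation Δ D) (d e : Δ) (a b : D),
      e ∈ I.ars d → I.feature g d = some a → I.feature f e = some b →
      (e ∈ s.eval I d ↔ a = b) := by
  obtain ⟨φ, hq, he, hφ⟩ := h
  obtain ⟨s, hs⟩ := exists_setTerm_of_isQF D g f hq rfl he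
  exact ⟨s, fun I d e a b h₁ h₂ h₃ => (hs I d e a b default h₁ h₂ h₃).trans (hφ a b)⟩

/-! ### Affine rewriting systems -/

/-- A rule that rewrites each register `j` from `c j + m j * t` to `b j + a j * t`. -/
structure AffineRule (J : Type) where
  m : J → ℕ
  c : J → ℕ
  a : J → ℕ
  b : J → ℕ

/-- The rule rewrites `x` to `y` with parameters `t`. -/
def AffineRule.Rewrites {J : Type} (ρ : AffineRule J) (t x y : J → ℕ) : Prop :=
  ∀ j, x j = ρ.c j + ρ.m j * t j ∧ y j = ρ.b j + ρ.a j * t j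

/-- There is an infinite rewriting sequence from `x₀` with the rules in `R`. -/
def HasInfiniteRun {J : Type} (R : List (AffineRule J)) (x₀ : J → ℕ) : Prop :=
  ∃ x : ℕ → J → ℕ, x 0 = x₀ ∧ ∀ n, ∃ ρ ∈ R, ∃ t, ρ.Rewrites t (x n) (x (n + 1))

-- Affine rewriting systems as TBoxes

section Reduction

variable {L : FirstOrder.Language.{0, 0}} {J : Type} [Fintype J] [Encodable J]

/-- The rule `ρ` is applied to the features `2 j`, the results are the features `2 j + 1`, and they
are passed on to the features `2 j` of the successors for the role `0`. The parameters are the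
numbers of successors for the roles `j + 1`. -/
noncomputable def AffineRule.toConcept (eq : FeatureName → FeatureName → SetTerm L)
    (ρ : AffineRule J) : DLConcept L :=
  .conj (Finset.univ.toList.map fun j =>
    .and (.suc (.mixed (2 * Encodable.encode j)
        (.addCard (.const (ρ.c j)) (ρ.m j) (.role (Encodable.encode j + 1)))))
      (.and (.suc (.mixed (2 * Encodable.encode j + 1)
          (.addCard (.const (ρ.b j)) (ρ.a j) (.role (Encodable.encode j + 1)))))
        (.suc (.setSubset (.role 0)
          (eq (2 * Encodable.encode j + 1) (2 * Encodable.encode j))))))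

/-- The TBox whose models are the infinite rewriting sequences from `x₀`. -/
noncomputable def rewritingTBox (eq : FeatureName → FeatureName → SetTerm L)
    (R : List (AffineRule J)) (x₀ : J → ℕ) : TBox L :=
  (.top L, .and (.ex 0 (.top L)) (.disj (R.map (AffineRule.toConcept eq)))) ::
    Finset.univ.toList.map fun j =>
      (.nominal 0, .suc (.mixed (2 * Encodable.encode j) (.const (x₀ j))))

variable {D : Type} [L.Structure D] [NatCast D]

theorem AffineRule.mem_interp_toConcept {eq : FeatureName → FeatureName → SetTerm L}
    {ρ : AffineRule J} {Δ : Type} {I : Interpretation Δ D} {d : Δ} :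
    d ∈ (ρ.toConcept eq).interp I ↔ ∀ j,
      I.feature (2 * Encodable.encode j) d = some
        ((ρ.c j + ρ.m j * {e | I.role (Encodable.encode j + 1) d e}.ncard : ℕ) : D) ∧
      I.feature (2 * Encodable.encode j + 1) d = some
        ((ρ.b j + ρ.a j * {e | I.role (Encodable.encode j + 1) d e}.ncard : ℕ) : D) ∧
      ∀ e, I.role 0 d e →
        e ∈ (eq (2 * Encodable.encode j + 1) (2 * Encodable.encode j)).eval I d := by
  simp [AffineRule.toConcept, DLConcept.mem_interp_conj, DLConcept.interp, SuccConstraint.Holds,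
    PAExpr.eval, SetTerm.eval, Set.subset_def]

theorem rewritingTBox_models_iff {eq : FeatureName → FeatureName → SetTerm L}
    {R : List (AffineRule J)} {x₀ : J → ℕ} {Δ : Type} {I : Interpretation Δ D} :
    (∀ ci ∈ rewritingTBox eq R x₀, ci.1.interp I ⊆ ci.2.interp I) ↔
      (∀ d, (∃ e, I.role 0 d e) ∧ ∃ ρ ∈ R, d ∈ (ρ.toConcept eq).interp I) ∧
      ∀ j, I.feature (2 * Encodable.encode j) (I.individual 0) = some ((x₀ j : ℕ) : D) := by
  simp [rewritingTBox, DLConcept.mem_interp_disj, DLConcept.interp, SuccConstraint.Holds,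
    PAExpr.eval, DLConcept.interp_top, Set.subset_def]

theorem rewritingTBox_consistent_iff (hD : Function.Injective (Nat.cast : ℕ → D))
    {eq : FeatureName → FeatureName → SetTerm L}
    (heq : ∀ g f, ∀ {Δ : Type} (I : Interpretation Δ D) (d e : Δ) (a b : D),
      e ∈ I.ars d → I.feature g d = some a → I.feature f e = some b →
      (e ∈ (eq g f).eval I d ↔ a = b))
    (R : List (AffineRule J)) (x₀ : J → ℕ) :
    (rewritingTBox eq R x₀).Consistent D ↔ HasInfiniteRun R x₀ := by
  simp only [TBox.Consistent, rewritingTBox_models_iff, AffineRule.mem_interp_toConcept]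
  constructor
  · rintro ⟨Δ, -, I, -, hstep, hinit⟩
    have hsucc := fun d => (hstep d).1
    have hrule := fun d => (hstep d).2
    choose next hnext using hsucc
    choose ρ hρR hρ using hrule
    set t : Δ → J → ℕ := fun d j => {e | I.role (Encodable.encode j + 1) d e}.ncard
    set u : Δ → J → ℕ := fun d j => (ρ d).c j + (ρ d).m j * t d j
    -- `u d j` is the natural number whose cast is feature `2 j` at `d`. Injectivity of the cast
    -- brings equalities of feature values back to `ℕ`.
    refine ⟨fun n => u (next^[n] (I.individual 0)), ?_, fun n => ?_⟩
    · funext j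
      exact hD (Option.some_injective _ (((hρ _ j).1).symm.trans (hinit j)))
    · set d := next^[n] (I.individual 0)
      refine ⟨ρ d, hρR d, t d, fun j => ⟨rfl, ?_⟩⟩
      have h := (heq _ _ I d (next d) _ _ ⟨0, hnext d⟩ (hρ d j).2.1 (hρ (next d) j).1).1
        ((hρ d j).2.2 _ (hnext d))
      change u (next^[n + 1] (I.individual 0)) j = _
      rw [Function.iterate_succ_apply']
      exact (hD h).symm
  · rintro ⟨x, rfl, hx⟩
    choose ρ hρR t hρ using hx
    -- Element `n` is the `n`-th configuration, and the parity of the feature chooses between `x n`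
    -- and `x (n + 1)`. Successors along role `j + 1` only have to be counted, so the elements below
    -- `t n j` serve.
    let I : Interpretation ℕ D :=
      { concept := fun _ => ∅
        role := fun r n k => r = 0 ∧ k = n + 1 ∨ ∃ j, r = Encodable.encode j + 1 ∧ k < t n j
        individual := fun _ => 0
        feature := fun f n =>
          (Encodable.decode (α := J) (f / 2)).map fun j => (x (n + f % 2) j : D) }
    have hrole : ∀ n k, I.role 0 n k ↔ k = n + 1 := by simp [I]
    have hcard : ∀ n j, {k | I.role (Encodable.encode j + 1) n k}.ncard = t n j := by
      intro n j
      have : {k | I.role (Encodable.encode j + 1) n k} = Finset.range (t n j) := by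
        ext k; simp [I]
      rw [this, Set.ncard_coe_finset, Finset.card_range]
    have hf : ∀ n j, I.feature (2 * Encodable.encode j) n = some (x n j : D) := by
      simp [I]
    have hg : ∀ n j, I.feature (2 * Encodable.encode j + 1) n = some (x (n + 1) j : D) := by
      intro n j
      have h₁ : (2 * Encodable.encode j + 1) / 2 = Encodable.encode j := by omega
      have h₂ : (2 * Encodable.encode j + 1) % 2 = 1 := by omega
      simp [I, h₁, h₂]
    refine ⟨ℕ, ⟨0⟩, I, fun n => ?_, fun n => ⟨⟨n + 1, (hrole _ _).2 rfl⟩, ρ n, hρR n, fun j => ?_⟩,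
      fun j => hf 0 j⟩
    · refine ((Set.finite_singleton (n + 1)).union
        (Set.finite_iUnion fun j => Set.finite_Iio (t n j))).subset ?_
      rintro k ⟨r, ⟨-, rfl⟩ | ⟨j, -, hk⟩⟩
      · exact .inl rfl
      · exact .inr (Set.mem_iUnion.2 ⟨j, hk⟩)
    · refine ⟨?_, ?_, fun e he => ?_⟩
      · rw [hf, hcard, (hρ n j).1]
      · rw [hg, hcard, (hρ n j).2]
      · obtain rfl := (hrole _ _).1 he
        exact (heq _ _ I n (n + 1) _ _ ⟨0, he⟩ (hg n j) (hf (n + 1) j)).2 rfl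

/-- Only the inclusions for the initial values depend on `n`; the noncomputably chosen remainder
contributes one constant code. -/
theorem computable_rewritingTBox_code [Encodable (Σ k, L.Relations k)]
    (eq : FeatureName → FeatureName → SetTerm L) (R : List (AffineRule J)) {x₀ : ℕ → J → ℕ}
    (hx : ∀ j, Computable fun n => x₀ n j) :
    Computable fun n => (rewritingTBox eq R (x₀ n)).code := by
  have pair : ∀ {f : ℕ → ℕ} (k : ℕ), Computable f → Computable fun n => Nat.pair k (f n) :=
    fun k hf => Primrec₂.natPair.to_comp.comp (Computable.const k) hf
  have hl : ∀ l : List J, Computable fun n => l.map fun j => Nat.pair (Nat.pair 1 0)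
      (Nat.pair 6 (Nat.pair 5 (Nat.pair (2 * Encodable.encode j) (Nat.pair 0 (x₀ n j))))) := by
    intro l
    induction l with
    | nil => exact Computable.const _
    | cons j l ih =>
      exact Computable.list_cons.comp (pair _ (pair _ (pair _ (pair _ (pair _ (hx j)))))) ih
  refine (Computable.encode.comp (Computable.list_cons.comp (Computable.const (Nat.pair
    (DLConcept.top L).code (DLConcept.and (.ex 0 (.top L))
      (.disj (R.map (AffineRule.toConcept eq)))).code)) (hl Finset.univ.toList))).of_eq fun n => ?_
  simp only [TBox.code, rewritingTBox, List.map_cons, List.map_map]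
  rfl

/-- Consistency of TBoxes decides whether an affine rewriting system has an infinite run. -/
theorem ConsistencyDecidable.hasInfiniteRun [L.IsRelational] [Encodable (Σ k, L.Relations k)]
    (hD : Function.Injective (Nat.cast : ℕ → D)) (hJD : JointlyDiagonal L D)
    (h : ConsistencyDecidable L D) (R : List (AffineRule J)) {x₀ : ℕ → J → ℕ}
    (hx : ∀ j, Computable fun n => x₀ n j) :
    ComputablePred fun n => HasInfiniteRun R (x₀ n) := by
  obtain ⟨p, hp, hT⟩ := h
  choose eq heq using fun g f => hJD.exists_setTerm g f
  refine ComputablePred.computable_of_manyOneReducible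
    ⟨_, computable_rewritingTBox_code eq R hx, fun n => ?_⟩ hp
  exact ((hT _).trans (rewritingTBox_consistent_iff hD heq R (x₀ n))).symm

end Reduction

/-! ### Stack machines as affine rewriting systems -/

section StackMachine

open Turing StateTransition

variable {K G Λ σ : Type}

/-! #### Stacks as numbers -/

section Digits

variable [Fintype G]

/-- The digit of a stack symbol; the digit `0` is not used. -/
noncomputable def stackDigit (γ : G) : ℕ := (Fintype.equivFin G γ : ℕ) + 1

/-- The number whose digits, from the least significant one on, are the symbols of the stack. -/
noncomputable def stackNumber : List G → ℕ
  | [] => 0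
  | γ :: l => stackDigit γ + (Fintype.card G + 1) * stackNumber l

theorem stackDigit_add_mul_inj {γ γ' : G} {t t' : ℕ}
    (h : stackDigit γ + (Fintype.card G + 1) * t = stackDigit γ' + (Fintype.card G + 1) * t') :
    γ = γ' ∧ t = t' := by
  have lt : ∀ γ : G, stackDigit γ < Fintype.card G + 1 := fun γ =>
    Nat.succ_lt_succ (Fintype.equivFin G γ).isLt
  have hd : stackDigit γ = stackDigit γ' := by
    simpa [Nat.add_mul_mod_self_left, Nat.mod_eq_of_lt (lt _)] using
      congrArg (· % (Fintype.card G + 1)) h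
  refine ⟨(Fintype.equivFin G).injective (Fin.ext (Nat.succ_injective hd)), ?_⟩
  rw [hd] at h
  exact Nat.eq_of_mul_eq_mul_left (Nat.succ_pos _) (Nat.add_left_cancel h)

theorem stackNumber_eq_zero {l : List G} (h : stackNumber l = 0) : l = [] := by
  cases l with
  | nil => rfl
  | cons γ l => simp [stackNumber, stackDigit] at h

/-- Since the digit `0` never occurs, the affine shape of the number alone reveals the top symbol,
and the parameter is the rest of the stack. -/
theorem stackNumber_eq_add_mul {l : List G} {γ : G} {t : ℕ}
    (h : stackNumber l = stackDigit γ + (Fintype.card G + 1) * t) :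
    ∃ l', l = γ :: l' ∧ t = stackNumber l' := by
  cases l with
  | nil => simp [stackNumber, stackDigit] at h; omega
  | cons γ' l =>
    obtain ⟨rfl, rfl⟩ := stackDigit_add_mul_inj h
    exact ⟨l, rfl, rfl⟩

end Digits

/-! #### Single steps -/

/-- Configurations of a stack machine between two operations. -/
abbrev OpCfg (K G Λ σ : Type) := (TM2.Stmt (fun _ : K => G) Λ σ × σ) × (K → List G)

/-- The execution of a single operation. -/
def opStep [DecidableEq K] (M : Λ → TM2.Stmt (fun _ : K => G) Λ σ) :
    OpCfg K G Λ σ → Option (OpCfg K G Λ σ)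
  | ((.push k f q, v), S) => some ((q, v), Function.update S k (f v :: S k))
  | ((.peek k f q, v), S) => some ((q, f v (S k).head?), S)
  | ((.pop k f q, v), S) => some ((q, f v (S k).head?), Function.update S k (S k).tail)
  | ((.load f q, v), S) => some ((q, f v), S)
  | ((.branch f q₁ q₂, v), S) => some ((cond (f v) q₁ q₂, v), S)
  | ((.goto l, v), S) => some ((M (l v), v), S)
  | ((.halt, _), _) => none

/-- The relation between the configurations of the machine and those between two operations. -/
inductive MatchesOpCfg : TM2.Cfg (fun _ : K => G) Λ σ → OpCfg K G Λ σ → Prop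
  | goto (l : σ → Λ) (v : σ) (S : K → List G) :
      MatchesOpCfg ⟨some (l v), v, S⟩ ((.goto l, v), S)
  | halt (v : σ) (S : K → List G) : MatchesOpCfg ⟨none, v, S⟩ ((.halt, v), S)

/-- One step of the machine runs a whole statement up to its `goto` or `halt`, whereas an affine
rule can perform just one operation; this connects the two granularities. -/
theorem exists_matchesOpCfg_stepAux [DecidableEq K] (M : Λ → TM2.Stmt (fun _ : K => G) Λ σ)
    (q : TM2.Stmt (fun _ : K => G) Λ σ) (v : σ) (S : K → List G) :
    ∃ b, MatchesOpCfg (TM2.stepAux q v S) b ∧ Reaches (opStep M) ((q, v), S) b := by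
  induction q generalizing v S with
  | goto l => exact ⟨_, .goto l v S, .refl⟩
  | halt => exact ⟨_, .halt v S, .refl⟩
  | branch f q₁ q₂ ih₁ ih₂ =>
    rcases h : f v
    · obtain ⟨b, hb, hr⟩ := ih₂ v S
      exact ⟨b, by simpa [h] using hb, .head (by simp [opStep, h]) hr⟩
    · obtain ⟨b, hb, hr⟩ := ih₁ v S
      exact ⟨b, by simpa [h] using hb, .head (by simp [opStep, h]) hr⟩
  | load _ _ ih | push _ _ _ ih | peek _ _ _ ih | pop _ _ _ ih =>
    obtain ⟨b, hb, hr⟩ := ih _ _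
    exact ⟨b, hb, .head rfl hr⟩

theorem respects_opStep [DecidableEq K] (M : Λ → TM2.Stmt (fun _ : K => G) Λ σ) :
    Respects (TM2.step M) (opStep M) MatchesOpCfg := by
  rintro _ _ (⟨l, v, S⟩ | ⟨v, S⟩)
  · obtain ⟨b, hb, hr⟩ := exists_matchesOpCfg_stepAux M (M (l v)) v S
    exact ⟨b, hb, .head' rfl hr⟩
  · rfl

/-! #### Operations as affine rules -/

/-- An operation on the stack `k` that replaces the number `c + m * t` by `b + a * t`. -/
structure OpRule (K Q : Type) where
  k : K
  m : ℕ
  c : ℕ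
  a : ℕ
  b : ℕ
  next : Q

section Rules

variable [Fintype G] [DecidableEq K]

/-- The affine rule for an operation: the register `none` holds the number of the state. -/
noncomputable def OpRule.toAffineRule {Q : Type} (ν : Q → ℕ) (q : Q) (τ : OpRule K Q) :
    AffineRule (Option K) where
  m j := j.elim 0 fun k => if k = τ.k then τ.m else 1
  c j := j.elim (ν q) fun k => if k = τ.k then τ.c else 0
  a j := j.elim 0 fun k => if k = τ.k then τ.a else 1
  b j := j.elim (ν τ.next) fun k => if k = τ.k then τ.b else 0

/-- The registers that represent a configuration. -/
noncomputable def OpCfg.registers (ν : TM2.Stmt (fun _ : K => G) Λ σ × σ → ℕ)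
    (c : OpCfg K G Λ σ) (j : Option K) : ℕ :=
  j.elim (ν c.1) fun k => stackNumber (c.2 k)

/-- The state register has slope `0`, so it is a plain test and assignment; untouched stacks have
slope `1` and offset `0`, so they are copied. -/
theorem OpRule.rewrites_registers_iff {ν : TM2.Stmt (fun _ : K => G) Λ σ × σ → ℕ}
    {q : TM2.Stmt (fun _ : K => G) Λ σ × σ} {c : OpCfg K G Λ σ}
    {τ : OpRule K (TM2.Stmt (fun _ : K => G) Λ σ × σ)} {t y : Option K → ℕ} :
    (τ.toAffineRule ν q).Rewrites t (c.registers ν) y ↔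
      (ν c.1 = ν q ∧ y none = ν τ.next) ∧
      (stackNumber (c.2 τ.k) = τ.c + τ.m * t (some τ.k) ∧
        y (some τ.k) = τ.b + τ.a * t (some τ.k)) ∧
      ∀ k, k ≠ τ.k → stackNumber (c.2 k) = t (some k) ∧ y (some k) = t (some k) := by
  simp only [AffineRule.Rewrites, Option.forall, OpCfg.registers, OpRule.toAffineRule,
    Option.elim]
  refine and_congr (by simp) ⟨fun h => ⟨by simpa using h τ.k, fun k hk => by simpa [hk] using h k⟩,
    fun h k => ?_⟩
  by_cases hk : k = τ.k
  · subst hk; simpa using h.1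
  · simpa [hk] using h.2 k hk

variable [Inhabited K]

/-- The rules for the operation of a statement. -/
noncomputable def opRules (M : Λ → TM2.Stmt (fun _ : K => G) Λ σ) :
    TM2.Stmt (fun _ : K => G) Λ σ × σ → List (OpRule K (TM2.Stmt (fun _ : K => G) Λ σ × σ))
  | (.push k f q, v) => [⟨k, 1, 0, Fintype.card G + 1, stackDigit (f v), (q, v)⟩]
  -- The rule from `0` to `0` is the emptiness test; every other rule tests for one top symbol.
  | (.peek k f q, v) => ⟨k, 0, 0, 0, 0, (q, f v none)⟩ :: Finset.univ.toList.map fun γ : G =>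
      ⟨k, Fintype.card G + 1, stackDigit γ, Fintype.card G + 1, stackDigit γ, (q, f v (some γ))⟩
  | (.pop k f q, v) => ⟨k, 0, 0, 0, 0, (q, f v none)⟩ :: Finset.univ.toList.map fun γ : G =>
      ⟨k, Fintype.card G + 1, stackDigit γ, 1, 0, (q, f v (some γ))⟩
  -- No stack changes here, so an arbitrary one gets the identity rule.
  | (.load f q, v) => [⟨default, 1, 0, 1, 0, (q, f v)⟩]
  | (.branch f q₁ q₂, v) => [⟨default, 1, 0, 1, 0, (cond (f v) q₁ q₂, v)⟩]
  | (.goto l, v) => [⟨default, 1, 0, 1, 0, (M (l v), v)⟩]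
  | (.halt, _) => []

theorem opStep_of_mem_opRules {M : Λ → TM2.Stmt (fun _ : K => G) Λ σ}
    {q : TM2.Stmt (fun _ : K => G) Λ σ × σ} {S : K → List G}
    {τ : OpRule K (TM2.Stmt (fun _ : K => G) Λ σ × σ)} (hτ : τ ∈ opRules M q) {t : ℕ}
    (ht : stackNumber (S τ.k) = τ.c + τ.m * t) :
    ∃ S', opStep M (q, S) = some (τ.next, S') ∧ stackNumber (S' τ.k) = τ.b + τ.a * t ∧
      ∀ k, k ≠ τ.k → S' k = S k := by
  obtain ⟨s, v⟩ := q
  cases s with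
  | push k f q =>
    obtain rfl := List.mem_singleton.1 hτ
    refine ⟨_, rfl, ?_, fun k' hk => Function.update_of_ne hk _ _⟩
    simp at ht
    simp [stackNumber, ht]
  | peek k f q =>
    simp only [opRules, List.mem_cons, List.mem_map, Finset.mem_toList] at hτ
    rcases hτ with rfl | ⟨γ, -, rfl⟩
    · have h := stackNumber_eq_zero (ht.trans (by simp))
      exact ⟨S, by simp [opStep, h], by simp [h, stackNumber], fun _ _ => rfl⟩
    · obtain ⟨l, hl, -⟩ := stackNumber_eq_add_mul ht
      exact ⟨S, by simp [opStep, hl], ht, fun _ _ => rfl⟩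
  | pop k f q =>
    simp only [opRules, List.mem_cons, List.mem_map, Finset.mem_toList] at hτ
    rcases hτ with rfl | ⟨γ, -, rfl⟩
    · have h := stackNumber_eq_zero (ht.trans (by simp))
      exact ⟨_, by simp [opStep, h]; rfl, by simp [stackNumber],
        fun k' hk => Function.update_of_ne hk _ _⟩
    · obtain ⟨l, hl, rfl⟩ := stackNumber_eq_add_mul ht
      exact ⟨_, by simp [opStep, hl]; rfl, by simp,
        fun k' hk => Function.update_of_ne hk _ _⟩
  | load | branch | goto =>
    obtain rfl := List.mem_singleton.1 hτ
    exact ⟨S, rfl, ht, fun _ _ => rfl⟩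
  | halt => simp [opRules] at hτ

theorem exists_mem_opRules {M : Λ → TM2.Stmt (fun _ : K => G) Λ σ}
    {q : TM2.Stmt (fun _ : K => G) Λ σ × σ} {S : K → List G} {c : OpCfg K G Λ σ}
    (h : opStep M (q, S) = some c) :
    ∃ τ ∈ opRules M q, ∃ t, stackNumber (S τ.k) = τ.c + τ.m * t := by
  obtain ⟨s, v⟩ := q
  cases s with
  | peek k f q | pop k f q =>
    rcases hS : S k with _ | ⟨γ, l⟩
    · exact ⟨_, List.mem_cons_self, 0, by simp [hS, stackNumber]⟩
    · exact ⟨_, List.mem_cons_of_mem _ (List.mem_map.2 ⟨γ, by simp, rfl⟩), stackNumber l,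
        by simp [hS, stackNumber]⟩
  | push | load | branch | goto =>
    exact ⟨_, List.mem_singleton_self _, _, (by simp; rfl)⟩
  | halt => simp [opStep] at h

variable {M : Λ → TM2.Stmt (fun _ : K => G) Λ σ} {ν : TM2.Stmt (fun _ : K => G) Λ σ × σ → ℕ}

theorem exists_opStep_of_rewrites {q : TM2.Stmt (fun _ : K => G) Λ σ × σ} {c : OpCfg K G Λ σ}
    {τ : OpRule K (TM2.Stmt (fun _ : K => G) Λ σ × σ)} (hτ : τ ∈ opRules M q)
    {t y : Option K → ℕ} (hq : ν c.1 = ν q → c.1 = q)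
    (h : (τ.toAffineRule ν q).Rewrites t (c.registers ν) y) :
    ∃ c', opStep M c = some c' ∧ y = c'.registers ν := by
  obtain ⟨⟨h₁, h₂⟩, ⟨h₃, h₄⟩, h₅⟩ := OpRule.rewrites_registers_iff.1 h
  obtain ⟨q', S⟩ := c
  obtain rfl : q' = q := hq h₁
  obtain ⟨S', hS', h₆, h₇⟩ := opStep_of_mem_opRules hτ h₃
  refine ⟨_, hS', funext fun j => ?_⟩
  rcases j with _ | k
  · exact h₂
  · by_cases hk : k = τ.k
    · subst hk; exact h₄.trans h₆.symm
    · exact ((h₅ k hk).2.trans (h₅ k hk).1.symm).trans (congrArg stackNumber (h₇ k hk).symm)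

theorem exists_rewrites_of_opStep {c c' : OpCfg K G Λ σ} (h : opStep M c = some c') :
    ∃ τ ∈ opRules M c.1, ∃ t,
      (τ.toAffineRule ν c.1).Rewrites t (c.registers ν) (c'.registers ν) := by
  obtain ⟨q, S⟩ := c
  obtain ⟨τ, hτ, t, ht⟩ := exists_mem_opRules h
  obtain ⟨S', hS', h₁, h₂⟩ := opStep_of_mem_opRules hτ ht
  obtain rfl := Option.some_injective _ (h.symm.trans hS')
  -- For a copied stack the parameter is its own number.
  refine ⟨τ, hτ, fun j => j.elim 0 fun k => if k = τ.k then t else stackNumber (S k),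
    OpRule.rewrites_registers_iff.2 ⟨⟨rfl, rfl⟩, ⟨by simpa using ht, ?_⟩, fun k hk => ?_⟩⟩
  · simpa [OpCfg.registers] using h₁
  · simp [OpCfg.registers, hk, h₂ k hk]

/-- Any rewriting of an encoded configuration is the deterministic step of the machine, so an
infinite run visits every reachable configuration and none of them can be final. It is enough that
`ν` separates the states in the closed set `F`. -/
theorem hasInfiniteRun_opRules_iff {F : Finset (TM2.Stmt (fun _ : K => G) Λ σ × σ)}
    (hν : Set.InjOn ν F)
    (hF : ∀ c c', c.1 ∈ F → opStep M c = some c' → c'.1 ∈ F)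
    {c₀ : OpCfg K G Λ σ} (hc₀ : c₀.1 ∈ F) :
    HasInfiniteRun (F.toList.flatMap fun q => (opRules M q).map (OpRule.toAffineRule ν q))
      (c₀.registers ν) ↔ ¬ (eval (opStep M) c₀).Dom := by
  have hreach : ∀ c, Reaches (opStep M) c₀ c → c.1 ∈ F := by
    intro c hc
    induction hc with
    | refl => exact hc₀
    | tail _ h ih => exact hF _ _ ih h
  constructor
  · rintro ⟨x, hx₀, hx⟩ hdom
    have hstep : ∀ n c, c.1 ∈ F → x n = c.registers ν →
        ∃ c', opStep M c = some c' ∧ x (n + 1) = c'.registers ν := by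
      intro n c hc hn
      obtain ⟨ρ, hρ, t, h⟩ := hx n
      simp only [List.mem_flatMap, Finset.mem_toList, List.mem_map] at hρ
      obtain ⟨q, hq, τ, hτ, rfl⟩ := hρ
      rw [hn] at h
      exact exists_opStep_of_rewrites hτ (fun e => hν hc hq e) h
    have hrun : ∀ c, Reaches (opStep M) c₀ c → ∃ n, x n = c.registers ν := by
      intro c hc
      induction hc with
      | refl => exact ⟨0, hx₀⟩
      | tail hc h ih =>
        obtain ⟨n, hn⟩ := ih
        obtain ⟨c', hc', hn'⟩ := hstep n _ (hreach _ hc) hn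
        obtain rfl := Option.some_injective _ (hc'.symm.trans h)
        exact ⟨n + 1, hn'⟩
    obtain ⟨hc, hnone⟩ := mem_eval.1 (Part.get_mem hdom)
    obtain ⟨n, hn⟩ := hrun _ hc
    obtain ⟨c', hc', -⟩ := hstep n _ (hreach _ hc) hn
    rw [hnone] at hc'
    cases hc'
  · intro hdom
    have hsome : ∀ c, Reaches (opStep M) c₀ c → ∃ c', opStep M c = some c' := by
      intro c hc
      rcases h : opStep M c with _ | c'
      · exact (hdom (Part.dom_iff_mem.2 ⟨c, mem_eval.2 ⟨hc, h⟩⟩)).elim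
      · exact ⟨c', rfl⟩
    -- The default is never taken on reachable configurations, by `hsome`.
    let next : OpCfg K G Λ σ → OpCfg K G Λ σ := fun c => (opStep M c).getD c
    have hseq : ∀ n, Reaches (opStep M) c₀ (next^[n] c₀) ∧
        opStep M (next^[n] c₀) = some (next^[n + 1] c₀) := by
      intro n
      have h : Reaches (opStep M) c₀ (next^[n] c₀) := by
        induction n with
        | zero => exact .refl
        | succ n ih =>
          obtain ⟨c', hc'⟩ := hsome _ ih
          rw [Function.iterate_succ_apply']
          exact ih.tail (by simp [next, hc'])
      obtain ⟨c', hc'⟩ := hsome _ h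
      exact ⟨h, by rw [Function.iterate_succ_apply']; simp [next, hc']⟩
    refine ⟨fun n => (next^[n] c₀).registers ν, rfl, fun n => ?_⟩
    obtain ⟨τ, hτ, t, ht⟩ := exists_rewrites_of_opStep (ν := ν) (hseq n).2
    exact ⟨_, List.mem_flatMap.2 ⟨_, Finset.mem_toList.2 (hreach _ (hseq n).1),
      List.mem_map.2 ⟨τ, hτ, rfl⟩⟩, t, ht⟩

/-- A stack machine with finitely many labels is simulated by an affine rewriting system that
diverges iff the machine does. -/
theorem exists_affineRules_of_supports [Fintype σ] (M : Λ → TM2.Stmt (fun _ : K => G) Λ σ)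
    {S : Finset Λ} (hS : ∀ l ∈ S, TM2.SupportsStmt S (M l)) {l₀ : Λ} (hl₀ : l₀ ∈ S) (v₀ : σ) :
    ∃ (R : List (AffineRule (Option K))) (q₀ : ℕ), ∀ T : K → List G,
      HasInfiniteRun R (fun j => j.elim q₀ fun k => stackNumber (T k)) ↔
        ¬ (eval (TM2.step M) ⟨some l₀, v₀, T⟩).Dom := by
  classical
  -- The simulation starts at an artificial jump to `l₀`, which need not be a statement of the
  -- machine.
  let A : Finset (TM2.Stmt (fun _ : K => G) Λ σ) :=
    insert (.goto fun _ => l₀) (Finset.eraseNone (TM2.stmts M S))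
  let F : Finset (TM2.Stmt (fun _ : K => G) Λ σ × σ) := A ×ˢ Finset.univ
  have hsub : ∀ {s s'}, s ∈ A → s' ∈ TM2.stmts₁ s → s' ∈ A := by
    intro s s' hs hs'
    simp only [A, Finset.mem_insert, Finset.mem_eraseNone] at hs ⊢
    rcases hs with rfl | hs
    · simp only [TM2.stmts₁, Finset.mem_singleton] at hs'
      exact .inl hs'
    · exact .inr (TM2.stmts_trans hs' hs)
  have hgoto : ∀ {l : σ → Λ}, .goto l ∈ A → ∀ v, M (l v) ∈ A := by
    intro l hl v
    have hlS : l v ∈ S := by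
      simp only [A, Finset.mem_insert, Finset.mem_eraseNone] at hl
      rcases hl with hl | hl
      · cases hl; exact hl₀
      · exact (@TM2.stmts_supportsStmt _ _ _ _ ⟨l₀⟩ M S _ ⟨hl₀, hS⟩ hl) v
    simp only [A, Finset.mem_insert, Finset.mem_eraseNone, TM2.stmts, Finset.some_mem_insertNone,
      Finset.mem_biUnion]
    exact .inr ⟨_, hlS, TM2.stmts₁_self⟩
  have hF : ∀ c c', c.1 ∈ F → opStep M c = some c' → c'.1 ∈ F := by
    rintro ⟨⟨s, v⟩, T⟩ c' hc h
    simp only [F, Finset.mem_product, Finset.mem_univ, and_true] at hc ⊢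
    cases s with
    | halt => cases h
    | goto l => cases h; exact hgoto hc v
    | branch f q₁ q₂ =>
      cases h
      refine hsub hc ?_
      cases f v <;> simp [TM2.stmts₁, TM2.stmts₁_self]
    | load | push | peek | pop =>
      cases h
      exact hsub hc (by simp [TM2.stmts₁, TM2.stmts₁_self])
  obtain ⟨ν, hν⟩ := Set.countable_iff_exists_injOn.1 F.countable_toSet
  refine ⟨F.toList.flatMap fun q => (opRules M q).map (OpRule.toAffineRule ν q),
    ν (.goto fun _ => l₀, v₀), fun T => ?_⟩
  exact (hasInfiniteRun_opRules_iff hν hF (c₀ := ((.goto fun _ => l₀, v₀), T))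
    (by simp [F, A])).trans
    (not_congr (tr_eval_dom (respects_opStep M) (MatchesOpCfg.goto (fun _ => l₀) v₀ T)))

end Rules

end StackMachine

/-! ### The halting problem -/

section Halting

open Turing StateTransition

instance : Fintype PartrecToTM2.K' where
  elems := {.main, .rev, .aux, .stack}
  complete k := by cases k <;> simp

/-- Bits are listed from the least significant one on, which gives a recursion on `n / 2` for
computing the encoded input. -/
theorem trNat_of_pos {n : ℕ} (hn : 0 < n) : PartrecToTM2.trNat n =
    (if n % 2 = 0 then .bit0 else .bit1) :: PartrecToTM2.trNat (n / 2) := by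
  obtain ⟨m, rfl⟩ : ∃ m : Num, (m : ℕ) = n := ⟨n, Num.to_of_nat n⟩
  have h : ∀ m : Num, PartrecToTM2.trNat (m : ℕ) = PartrecToTM2.trNum m := fun m => by
    rw [PartrecToTM2.trNat, Num.of_to_nat]
  rcases m with _ | p | p | p
  · exact absurd hn (lt_irrefl 0)
  · change PartrecToTM2.trNat ((Num.pos .one : Num) : ℕ) = _
    rw [h]
    simp [PartrecToTM2.trNum, PartrecToTM2.trPosNum]
  · have e : ((Num.pos (.bit1 p) : Num) : ℕ) = 2 * ((Num.pos p : Num) : ℕ) + 1 := by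
      change ((p : ℕ) + (p : ℕ)) + 1 = 2 * (p : ℕ) + 1
      omega
    have e₁ : (2 * ((Num.pos p : Num) : ℕ) + 1) / 2 = ((Num.pos p : Num) : ℕ) := by omega
    have e₂ : (2 * ((Num.pos p : Num) : ℕ) + 1) % 2 ≠ 0 := by omega
    rw [h, e, e₁, if_neg e₂, h]
    rfl
  · have e : ((Num.pos (.bit0 p) : Num) : ℕ) = 2 * ((Num.pos p : Num) : ℕ) := by
      change (p : ℕ) + (p : ℕ) = 2 * (p : ℕ)
      omega
    have e₁ : (2 * ((Num.pos p : Num) : ℕ)) / 2 = ((Num.pos p : Num) : ℕ) := by omega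
    have e₂ : (2 * ((Num.pos p : Num) : ℕ)) % 2 = 0 := by omega
    rw [h, e, e₁, if_pos e₂, h]
    rfl

theorem computable_stackNumber_trList :
    Computable fun n : ℕ => stackNumber (PartrecToTM2.trList [n]) := by
  set B := Fintype.card PartrecToTM2.Γ' + 1
  let f : Unit → ℕ → ℕ := fun _ n => stackNumber (PartrecToTM2.trList [n])
  -- In the course-of-values recursion `l` lists the values at all arguments below `n`, so its
  -- length is `n` and entry `n / 2` is the recursive value.
  let g : Unit → List ℕ → Option ℕ := fun _ l =>
    if l.length = 0 then some (stackNumber (PartrecToTM2.trList [0])) else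
      l[l.length / 2]?.map fun y =>
        (if l.length % 2 = 0 then stackDigit PartrecToTM2.Γ'.bit0
          else stackDigit PartrecToTM2.Γ'.bit1) + B * y
  have hlen : Primrec fun p : Unit × List ℕ => p.2.length := Primrec.list_length.comp Primrec.snd
  have hg : Primrec₂ g := by
    refine Primrec.ite (Primrec.eq.comp hlen (Primrec.const 0)) (Primrec.const _)
      (Primrec.option_map (Primrec.list_getElem?.comp Primrec.snd
        (Primrec.nat_div.comp hlen (Primrec.const 2))) ?_)
    exact Primrec.nat_add.comp
      (Primrec.ite (Primrec.eq.comp (Primrec.nat_mod.comp (hlen.comp Primrec.fst)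
        (Primrec.const 2)) (Primrec.const 0)) (Primrec.const _) (Primrec.const _))
      (Primrec.nat_mul.comp (Primrec.const B) Primrec.snd)
  have hf : Primrec₂ f := Primrec.nat_strong_rec f hg fun _ n => by
    rcases Nat.eq_zero_or_pos n with rfl | hn
    · simp [f, g]
    · have hlt : n / 2 < n := Nat.div_lt_self hn one_lt_two
      simp only [g, f, List.length_map, List.length_range, hn.ne', if_false,
        List.getElem?_map, List.getElem?_range hlt, Option.map_some, Option.some.injEq]
      simp only [PartrecToTM2.trList]
      rw [trNat_of_pos hn, List.cons_append, stackNumber]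
      split_ifs <;> rfl
  exact (hf.comp (Primrec.const ()) Primrec.id).to_comp

/-- It is undecidable for some affine rewriting system and a computable family of initial values
whether there is an infinite run. -/
theorem exists_not_computablePred_hasInfiniteRun :
    ∃ (R : List (AffineRule (Option PartrecToTM2.K'))) (x₀ : ℕ → Option PartrecToTM2.K' → ℕ),
      (∀ j, Computable fun n => x₀ n j) ∧ ¬ ComputablePred fun n => HasInfiniteRun R (x₀ n) := by
  have hpart : Nat.Partrec fun n =>
      -- A single machine runs the program with number `n` on input `0`; only its initial stack
      -- varies.
      Nat.Partrec.Code.eval (Denumerable.ofNat Nat.Partrec.Code n) 0 :=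
    Partrec.nat_iff.1 (Nat.Partrec.Code.eval_part.comp (Computable.ofNat _) (Computable.const 0))
  obtain ⟨c, hc⟩ := ToPartrec.Code.exists_code (Nat.Partrec'.part_iff₁.2 (Partrec.nat_iff.2 hpart))
  have hsupp := PartrecToTM2.tr_supports c .halt
  obtain ⟨R, q₀, hR⟩ := exists_affineRules_of_supports PartrecToTM2.tr hsupp.2 hsupp.1 none
  refine ⟨R, fun n j => j.elim q₀ fun k => stackNumber
    (PartrecToTM2.K'.elim (PartrecToTM2.trList [n]) [] [] [] k), fun j => ?_, fun h => ?_⟩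
  · rcases j with _ | _ | _ | _ | _
    · exact Computable.const _
    · exact computable_stackNumber_trList
    all_goals exact Computable.const _
  -- Infinite runs correspond to divergence, so the decision procedure is negated to decide halting.
  · refine ComputablePred.halting_problem 0 ?_
    refine ComputablePred.computable_of_manyOneReducible
      ⟨Encodable.encode, Computable.encode, fun e => ?_⟩ h.not
    simp only [hR, not_not]
    have h₁ := PartrecToTM2.tr_eval c [Encodable.encode e]
    have h₂ := hc ⟨[Encodable.encode e], rfl⟩
    rw [PartrecToTM2.init] at h₁
    change _ ↔ (eval (TM2.step PartrecToTM2.tr) _).Dom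
    rw [h₁]
    change _ ↔ (ToPartrec.Code.eval c [Encodable.encode e]).Dom
    rw [h₂]
    change _ ↔
      (Nat.Partrec.Code.eval (Denumerable.ofNat Nat.Partrec.Code (Encodable.encode e)) 0).Dom
    rw [Denumerable.ofNat_encode]

end Halting

theorem not_consistencyDecidable_of_jointlyDiagonal {L : FirstOrder.Language.{0, 0}}
    [L.IsRelational] [Encodable (Σ k, L.Relations k)] {D : Type} [L.Structure D] [NatCast D]
    (hD : Function.Injective (Nat.cast : ℕ → D)) (hJD : JointlyDiagonal L D) :
    ¬ ConsistencyDecidable L D := by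
  intro h
  obtain ⟨R, x₀, hx, hR⟩ := exists_not_computablePred_hasInfiniteRun
  -- The encoding merely names features and roles, so any one will do.
  let := Fintype.toEncodable (Option Turing.PartrecToTM2.K')
  exact hR (h.hasInfiniteRun hD hJD R hx)

theorem mainTheorem5 (L : FirstOrder.Language.{0, 0}) [L.IsRelational]
    [Encodable (Σ k, L.Relations k)] :
    (∀ [L.Structure ℕ], JointlyDiagonal L ℕ → ¬ ConsistencyDecidable L ℕ) ∧
    (∀ [L.Structure ℤ], JointlyDiagonal L ℤ → ¬ ConsistencyDecidable L ℤ) ∧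
    (∀ [L.Structure ℚ], JointlyDiagonal L ℚ → ¬ ConsistencyDecidable L ℚ) :=
  ⟨not_consistencyDecidable_of_jointlyDiagonal Nat.cast_injective,
    not_consistencyDecidable_of_jointlyDiagonal Nat.cast_injective,
    not_consistencyDecidable_of_jointlyDiagonal Nat.cast_injective⟩
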